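/- Let $k, \ell, D \in \mathbb{N} = \{0,1,2,\dots\}$ with $k \ge 1$, let $\alpha \in \{0,1\}$ and let $\varepsilon > 0$ be real. For a finite simple graph $G$ write $e(G)$ and $v(G)$ for its numbers of edges and vertices, and let its fractional arboricity be $$\gamma(G) = \max_{H \subseteq G,\ v(H) \ge 2} \frac{e(H)}{v(H) - 1},$$ the maximum being over all subgraphs $H$ of $G$ with at least two vertices. A pseudoforest is a graph in which every connected component contains at most one cycle, and a decomposition of $G$ into $k+1$ pseudoforests is a partition of the edge set of $G$ into $k+1$ (possibly empty) classes, each of which is the edge set of a pseudoforest on the vertex set of $G$. Then there exists a finite simple graph $G$ with $$\gamma(G) < k + \frac{\ell(k+1) + \alpha}{(\ell+1)(k+1) + \alpha} + \varepsilon$$ that has no decomposition into $k+1$ pseudoforests in which one of the pseudoforests has maximum degree at most $D$ and all of its connected components have diameter less than $2\ell + 1 + \alpha$. (The diameter of a connected graph is the maximum distance between two of its vertices.) -/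

import Mathlib

namespace SimpleGraph

variable {V : Type*}

/-- The densities `e(H) / (v(H) - 1)` of the subgraphs `H` of `G` with at least two vertices. -/
def arboricityDensities (G : SimpleGraph V) : Set ℝ :=
  {q | ∃ H : G.Subgraph, 2 ≤ H.verts.ncard ∧
    q = (H.edgeSet.ncard : ℝ) / ((H.verts.ncard : ℝ) - 1)}

/-- The fractional arboricity of a finite graph: the maximum of `e(H) / (v(H) - 1)` over the
subgraphs `H` with `v(H) ≥ 2`. For a finite graph there are finitely many subgraphs, so the
supremum is this maximum as soon as `G` has at least two vertices. -/
noncomputable def fracArboricity (G : SimpleGraph V) : ℝ :=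
  sSup G.arboricityDensities

/-- A pseudoforest is a graph each of whose connected components contains at most one cycle.
Cycles are compared as subgraphs, so the starting point and the direction of the closed walk that
traverses a cycle do not matter. -/
def IsPseudoforest (F : SimpleGraph V) : Prop :=
  ∀ (K : F.ConnectedComponent) ⦃u v : V⦄, u ∈ K.supp → v ∈ K.supp →
    ∀ (c : F.Walk u u) (c' : F.Walk v v), c.IsCycle → c'.IsCycle →
      c.toSubgraph = c'.toSubgraph

/-- The spanning subgraphs `F i` decompose `G`: their edge sets partition the edge set of `G`
(empty classes are allowed). -/
structure IsDecomposition {ι : Type*} (G : SimpleGraph V) (F : ι → SimpleGraph V) : Prop where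
  pairwise_disjoint : Pairwise fun i j => Disjoint (F i).edgeSet (F j).edgeSet
  iUnion_edgeSet : ⋃ i, (F i).edgeSet = G.edgeSet

end SimpleGraph

/-! The counterexample consists of `k` hubs and many copies of a tree on `T`, where a vertex `x` is
joined to all but `f x` hubs. Let `F` be the pseudoforest of bounded degree and small diameters. The
hubs have degree at most `D` in `F`, so at most `k * D` copies send an `F`-edge to a hub. In every
other copy all `k|T| - Σ f` hub edges lie in the remaining `k` pseudoforests, which together have at
most `k` edges per vertex. With enough copies, `F` then misses at most `Σ f` tree edges in one of
them and splits it into at most `Σ f + 1` pieces. If the tree has `Σ f + 2` tips at pairwise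
distance at least `2ℓ + 1 + α`, two tips share a piece, which is impossible (`lt_card_cut`,
`not_exists_isDecomposition_hubGraph`).

The tree must still be sparse together with its hub edges. It is a caterpillar with a path hung at
each node, of length `ℓ`, or `ℓ + α` at heavy nodes; the ends of these paths are the tips. Put `C =
(ℓ + 1)(k + 1) + α`, so the target density is `k + 1 - (k + 1)/C`. Give `x ∈ W` the weight `k + 1 -
C(1 + f x - [parent in W])`; the total weight is positive exactly when `W` exceeds the target. It is
nonpositive unless `W` contains every light node of the spine, and never exceeds `C`
(`sum_comb_weight_le`, `CatNode.sum_weight_le`). For a long spine this surplus is negligible against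
`|W|` and disappears in `ε`. -/

namespace SimpleGraph

/-! ### Edge counts of forests and pseudoforests -/

/-- A forest has at most as many edges as it has vertices minus components. -/
theorem IsAcyclic.ncard_edgeSet_add_card_connectedComponent_le {V : Type*} [Finite V]
    {G : SimpleGraph V} (hG : G.IsAcyclic) :
    G.edgeSet.ncard + Nat.card G.ConnectedComponent ≤ Nat.card V := by
  induction hn : G.edgeSet.ncard generalizing G with
  | zero =>
    rw [zero_add]
    exact Nat.card_le_card_of_surjective G.connectedComponentMk Quot.mk_surjective
  | succ n ih =>
    have hne : G.edgeSet.Nonempty := by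
      rw [← Set.ncard_pos (Set.toFinite _)]; omega
    obtain ⟨e, he⟩ := hne
    induction e using Sym2.ind with
    | _ u v =>
    have hle : G.deleteEdges {s(u, v)} ≤ G := G.deleteEdges_le _
    have hcard : (G.deleteEdges {s(u, v)}).edgeSet.ncard = n := by
      rw [edgeSet_deleteEdges, Set.ncard_sdiff_singleton_of_mem he, hn]; rfl
    have hlt : Nat.card G.ConnectedComponent <
        Nat.card (G.deleteEdges {s(u, v)}).ConnectedComponent := by
      -- Equal numbers would make the induced surjection on components injective, so `u` and `v`
      -- would stay connected; but every edge of a forest is a bridge.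
      refine lt_of_le_of_ne (ConnectedComponent.card_le_card_of_le hle) fun heq => ?_
      have hsurj : Function.Surjective (ConnectedComponent.map (Hom.ofLE hle)) := by
        intro K
        induction K using ConnectedComponent.ind with
        | _ w => exact ⟨(G.deleteEdges {s(u, v)}).connectedComponentMk w, rfl⟩
      have hinj := (Nat.bijective_iff_surjective_and_card _).2 ⟨hsurj, heq.symm⟩ |>.1
      have huv : (G.deleteEdges {s(u, v)}).connectedComponentMk u =
          (G.deleteEdges {s(u, v)}).connectedComponentMk v := by
        apply hinj
        exact ConnectedComponent.sound (Adj.reachable he)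
      have hb := isAcyclic_iff_forall_adj_isBridge.1 hG he
      rw [isBridge_iff] at hb
      exact hb (ConnectedComponent.exact huv)
    have := ih (hG.anti hle) hcard
    omega

/-- A pseudoforest has at most as many edges as vertices. -/
theorem IsPseudoforest.ncard_edgeSet_le {V : Type*} [Finite V] {F : SimpleGraph V}
    (hF : F.IsPseudoforest) : F.edgeSet.ncard ≤ Nat.card V := by
  classical
  rcases isEmpty_or_nonempty V with hV | hV
  · simp [Subsingleton.elim F ⊥]
  -- All cycles of a component coincide, hence share an edge. Deleting one such edge per component
  -- leaves a forest.
  have key : ∀ K : F.ConnectedComponent, ∃ e : Sym2 V, ∀ (u : V) (c : F.Walk u u),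
      u ∈ K.supp → c.IsCycle → e ∈ c.edges := by
    intro K
    by_cases h : ∃ (u : V) (c : F.Walk u u), u ∈ K.supp ∧ c.IsCycle
    · obtain ⟨u, c, hu, hc⟩ := h
      obtain ⟨e, he⟩ : ∃ e, e ∈ c.edges := by
        apply List.exists_mem_of_ne_nil
        intro h0
        exact hc.ne_nil (Walk.edges_eq_nil.1 h0 |> fun h => by
          cases h; rfl)
      refine ⟨e, fun v c' hv hc' => ?_⟩
      rw [← Walk.mem_edges_toSubgraph, ← hF K hu hv c c' hc hc']
      rwa [Walk.mem_edges_toSubgraph]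
    · push Not at h
      exact ⟨s(Classical.arbitrary V, Classical.arbitrary V), fun u c hu hc => (h u c hu hc).elim⟩
  choose pick hpick using key
  have hacyc : (F.deleteEdges (Set.range pick)).IsAcyclic := by
    intro u c hc
    have hle : F.deleteEdges (Set.range pick) ≤ F := F.deleteEdges_le _
    have h1 := hpick (F.connectedComponentMk u) u (c.mapLe hle) rfl (hc.mapLe hle)
    rw [Walk.edges_mapLe_eq_edges] at h1
    have h2 := c.edges_subset_edgeSet h1
    rw [edgeSet_deleteEdges] at h2
    exact h2.2 ⟨_, rfl⟩
  have h1 := hacyc.ncard_edgeSet_add_card_connectedComponent_le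
  have h2 := ConnectedComponent.card_le_card_of_le (F.deleteEdges_le (Set.range pick))
  have h3 : F.edgeSet.ncard ≤ (F.deleteEdges (Set.range pick)).edgeSet.ncard +
      (Set.range pick).ncard := by
    rw [edgeSet_deleteEdges]
    exact Set.ncard_le_ncard_sdiff_add_ncard _ _
  have h4 : (Set.range pick).ncard ≤ Nat.card F.ConnectedComponent := by
    rw [← Set.image_univ, ← Set.ncard_univ]
    exact Set.ncard_image_le
  omega

/-! ### The hub graph and its fractional arboricity -/

section HubGraph

variable {T : Type*} {k N : ℕ}

/-- The candidate edges of `hubGraph`: the pair of a vertex and its parent, in each of the `N`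
copies of a forest on `T`, and the pairs of a hub and a vertex of one of the copies. -/
def hubEdge (par : T → T) (t : (Fin N × T) × Option (Fin k)) : Sym2 (Fin k ⊕ Fin N × T) :=
  t.2.elim s(Sum.inr t.1, Sum.inr (t.1.1, par t.1.2)) fun j => s(Sum.inl j, Sum.inr t.1)

/-- `N` copies of the forest given by the parent map `par` together with `k` further vertices,
the hubs. A vertex `x` of a copy is joined to all but the first `f x` hubs. -/
def hubGraph (k N : ℕ) (f : T → ℕ) (par : T → T) : SimpleGraph (Fin k ⊕ Fin N × T) :=
  fromEdgeSet (hubEdge par '' {t | ∀ j ∈ t.2, f t.1.2 ≤ (j : ℕ)})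

variable {f : T → ℕ} {par : T → T} {rank : T → ℕ}

theorem mem_edgeSet_hubGraph {e : Sym2 (Fin k ⊕ Fin N × T)} :
    e ∈ (hubGraph k N f par).edgeSet ↔
      (∃ t : (Fin N × T) × Option (Fin k), (∀ j ∈ t.2, f t.1.2 ≤ (j : ℕ)) ∧ hubEdge par t = e) ∧
        ¬ e.IsDiag := by
  simp [hubGraph, edgeSet_fromEdgeSet]

theorem hubEdge_isDiag_iff {t : (Fin N × T) × Option (Fin k)} :
    (hubEdge par t).IsDiag ↔ t.2 = none ∧ par t.1.2 = t.1.2 := by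
  obtain ⟨⟨i, x⟩, _ | j⟩ := t <;> simp [hubEdge, eq_comm]

/-- The only possible coincidence is a pair of vertices that are each other's parents, and the rank
excludes it. Edges may therefore be counted through their index `t`. -/
theorem eq_of_hubEdge_eq (hrank : ∀ x, par x ≠ x → rank (par x) < rank x)
    {t t' : (Fin N × T) × Option (Fin k)} (hd : ¬ (hubEdge par t).IsDiag)
    (h : hubEdge par t = hubEdge par t') : t = t' := by
  have hd' := hd
  rw [h] at hd'
  rw [hubEdge_isDiag_iff] at hd hd'
  obtain ⟨⟨i, x⟩, _ | j⟩ := t <;> obtain ⟨⟨i', x'⟩, _ | j'⟩ := t' <;>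
    simp only [hubEdge, Option.elim, Sym2.eq_iff, Sum.inr.injEq, Prod.mk.injEq, Sum.inl.injEq,
      true_and, reduceCtorEq, false_and, and_false, or_false] at h hd hd' ⊢
  · rcases h with h | ⟨⟨rfl, h1⟩, _, h2⟩
    · exact ⟨h.1, trivial⟩
    · exfalso
      have a := hrank x hd
      have b := hrank x' hd'
      rw [h2] at a
      rw [← h1] at b
      omega
  · exact ⟨h.2, congrArg some h.1⟩

theorem sum_fin_ite (k n : ℕ) : (∑ j : Fin k, if n ≤ (j : ℕ) then 1 else 0) = k - n := by
  rw [Fin.sum_univ_eq_sum_range (fun j => if n ≤ j then 1 else 0) k, ← Finset.card_filter]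
  have : (Finset.range k).filter (fun j => n ≤ j) = Finset.Ico n k := by
    ext j; simp; omega
  rw [this, Nat.card_Ico]

open Classical in
/-- The fractional arboricity of the hub graph is controlled by the densities of the vertex sets
of a single copy, where the edges to the hubs are counted as well. -/
theorem fracArboricity_hubGraph_le [Fintype T]
    (hrank : ∀ x, par x ≠ x → rank (par x) < rank x) {Q : ℝ} (hQ : 1 ≤ Q)
    (hW : ∀ W : Finset T, ((∑ x ∈ W, ((k - f x) + if par x ≠ x ∧ par x ∈ W then 1 else 0) : ℕ) : ℝ)
      ≤ Q * W.card) :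
    (hubGraph k N f par).fracArboricity ≤ Q := by
  apply Real.sSup_le _ (by linarith)
  rintro q ⟨H, hv, rfl⟩
  have hv' : (2 : ℝ) ≤ H.verts.ncard := by exact_mod_cast hv
  rw [div_le_iff₀ (by linarith)]
  set W : Finset (Fin N × T) := Finset.univ.filter fun p => Sum.inr p ∈ H.verts with hWdef
  have hends : ∀ e ∈ H.edgeSet, ∀ v ∈ e, v ∈ H.verts := fun e he v hve =>
    H.mem_verts_of_mem_edge he hve
  have htok : ∀ e ∈ H.edgeSet, ∃ t : (Fin N × T) × Option (Fin k),
      (∀ j ∈ t.2, f t.1.2 ≤ (j : ℕ)) ∧ hubEdge par t = e ∧ t.1 ∈ W ∧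
        (t.2 = none → par t.1.2 ≠ t.1.2 ∧ (t.1.1, par t.1.2) ∈ W) ∧
        ∀ j ∈ t.2, Sum.inl j ∈ H.verts := by
    intro e he
    obtain ⟨⟨t, ht, rfl⟩, hd⟩ := mem_edgeSet_hubGraph.1 (H.edgeSet_subset he)
    rw [hubEdge_isDiag_iff] at hd
    have h1 := hends _ he
    refine ⟨t, ht, rfl, ?_⟩
    obtain ⟨⟨i, x⟩, _ | j⟩ := t
    · simp only [hubEdge, Option.elim, Sym2.mem_iff, forall_eq_or_imp, forall_eq] at h1
      simp only [true_and] at hd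
      simp [hWdef, h1, hd]
    · simp only [hubEdge, Option.elim, Sym2.mem_iff, forall_eq_or_imp, forall_eq] at h1
      simp [hWdef, h1]
  have hWcard : W.card = (Sum.inr '' (W : Set (Fin N × T)) : Set (Fin k ⊕ Fin N × T)).ncard := by
    rw [Set.ncard_image_of_injective _ Sum.inr_injective, Set.ncard_coe_finset]
  have hWsub : (Sum.inr '' (W : Set (Fin N × T)) : Set (Fin k ⊕ Fin N × T)) ⊆ H.verts := by
    rintro _ ⟨p, hp, rfl⟩
    simpa [hWdef] using hp
  by_cases hhub : ∃ j : Fin k, Sum.inl j ∈ H.verts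
  -- A hub in `H` accounts for the `-1` in `v(H) - 1`, so the edges can be compared with all of `W`,
  -- copy by copy.
  · obtain ⟨j₀, hj₀⟩ := hhub
    have hWv : (W.card : ℝ) ≤ H.verts.ncard - 1 := by
      have : W.card < H.verts.ncard := by
        rw [hWcard]
        refine Set.ncard_lt_ncard ⟨hWsub, fun hsub => ?_⟩ (Set.toFinite _)
        obtain ⟨p, -, hp⟩ := hsub hj₀
        cases hp
      have h2 : ((W.card + 1 : ℕ) : ℝ) ≤ H.verts.ncard := by exact_mod_cast this
      push_cast at h2
      linarith
    set τ : Finset ((Fin N × T) × Option (Fin k)) := Finset.univ.filter fun t =>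
      t.1 ∈ W ∧ t.2.elim (par t.1.2 ≠ t.1.2 ∧ (t.1.1, par t.1.2) ∈ W) fun j => f t.1.2 ≤ (j : ℕ)
      with hτ
    have hE : H.edgeSet.ncard ≤ τ.card := by
      rw [← Set.ncard_coe_finset]
      refine le_trans (Set.ncard_le_ncard ?_ (Set.toFinite _))
        (Set.ncard_image_le (f := hubEdge par) (Set.toFinite _))
      intro e he
      obtain ⟨t, h1, h2, h3, h4, -⟩ := htok e he
      refine ⟨t, ?_, h2⟩
      obtain ⟨⟨i, x⟩, _ | j⟩ := t
      · simpa [hτ, h3] using h4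
      · simpa [hτ, h3] using h1
    have hτcard : τ.card = ∑ i : Fin N, ∑ x ∈ Finset.univ.filter (fun x => (i, x) ∈ W),
        ((k - f x) + if par x ≠ x ∧ par x ∈ Finset.univ.filter (fun x => (i, x) ∈ W)
          then 1 else 0) := by
      rw [hτ, Finset.card_filter, Fintype.sum_prod_type, Fintype.sum_prod_type]
      refine Finset.sum_congr rfl fun i _ => ?_
      rw [Finset.sum_filter]
      refine Finset.sum_congr rfl fun x _ => ?_
      rw [Fintype.sum_option]
      by_cases hx : (i, x) ∈ W
      · simp only [hx, true_and, Option.elim, sum_fin_ite, Finset.mem_filter,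
          Finset.mem_univ, if_true]
        rw [add_comm]
      · simp [hx]
    have hWsum : W.card = ∑ i : Fin N, (Finset.univ.filter (fun x => (i, x) ∈ W)).card := by
      have : W = Finset.univ.filter (fun p => p ∈ W) := by ext; simp
      conv_lhs => rw [this]
      rw [Finset.card_filter, Fintype.sum_prod_type]
      simp only [Finset.card_filter]
    calc (H.edgeSet.ncard : ℝ) ≤ (τ.card : ℝ) := by exact_mod_cast hE
      _ ≤ Q * W.card := by
          rw [hτcard, hWsum, Nat.cast_sum, Nat.cast_sum, Finset.mul_sum]
          exact Finset.sum_le_sum fun i _ => hW _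
      _ ≤ Q * (H.verts.ncard - 1) := by gcongr
  · push Not at hhub
    have hWeq : W.card = H.verts.ncard := by
      rw [hWcard]
      congr 1
      refine hWsub.antisymm ?_
      rintro (j | p) hp
      · exact (hhub j hp).elim
      · exact ⟨p, by simpa [hWdef] using hp, rfl⟩
    -- Without hubs, each edge of `H` is charged to its child endpoint. A vertex of least rank is
    -- never charged, so the density is at most `1 ≤ Q`.
    obtain ⟨p₀, hp₀, hmin⟩ := W.exists_min_image (fun p => rank p.2)
      (Finset.card_pos.1 (by omega))
    have hE : H.edgeSet.ncard ≤ (W.erase p₀).card := by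
      rw [← Set.ncard_coe_finset]
      refine le_trans (Set.ncard_le_ncard ?_ (Set.toFinite _))
        (Set.ncard_image_le (f := fun p => hubEdge par (p, none)) (Set.toFinite _))
      intro e he
      obtain ⟨⟨p, o⟩, -, h2, h3, h4, h5⟩ := htok e he
      cases o with
      | some j => exact (hhub j (h5 j rfl)).elim
      | none =>
        refine ⟨p, ?_, h2⟩
        obtain ⟨h6, h7⟩ := h4 rfl
        simp only [Finset.coe_erase, Set.mem_sdiff, Finset.mem_coe, Set.mem_singleton_iff]
        refine ⟨h3, ?_⟩
        rintro rfl
        have := hmin _ h7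
        have := hrank _ h6
        simp only at *
        omega
    rw [Finset.card_erase_of_mem hp₀, hWeq] at hE
    have hE' : (H.edgeSet.ncard : ℝ) ≤ H.verts.ncard - 1 := by
      have : H.edgeSet.ncard + 1 ≤ H.verts.ncard := by omega
      have : ((H.edgeSet.ncard + 1 : ℕ) : ℝ) ≤ H.verts.ncard := by exact_mod_cast this
      push_cast at this
      linarith
    nlinarith

end HubGraph

/-! ### Impossibility of the decomposition -/

/-- The edges outside one class of a decomposition into `k + 1` pseudoforests number at most
`k` times the number of vertices. -/
theorem IsDecomposition.ncard_edgeSet_diff_le {V : Type*} [Finite V] {G : SimpleGraph V} {k : ℕ}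
    {F : Fin (k + 1) → SimpleGraph V} (hdec : G.IsDecomposition F)
    (hF : ∀ i, (F i).IsPseudoforest) (i₀ : Fin (k + 1)) :
    (G.edgeSet \ (F i₀).edgeSet).ncard ≤ k * Nat.card V := by
  have hsub : G.edgeSet \ (F i₀).edgeSet ⊆
      ⋃ i ∈ Finset.univ.erase i₀, (F i).edgeSet := by
    rintro e ⟨he, he'⟩
    rw [← hdec.iUnion_edgeSet] at he
    obtain ⟨i, hi⟩ := Set.mem_iUnion.1 he
    have : i ≠ i₀ := by rintro rfl; exact he' hi
    simp only [Set.mem_iUnion]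
    exact ⟨i, by simp [this], hi⟩
  calc _ ≤ (⋃ i ∈ Finset.univ.erase i₀, (F i).edgeSet).ncard :=
        Set.ncard_le_ncard hsub (Set.toFinite _)
    _ ≤ ∑ i ∈ Finset.univ.erase i₀, (F i).edgeSet.ncard := Finset.set_ncard_biUnion_le _ _
    _ ≤ ∑ i ∈ Finset.univ.erase i₀, Nat.card V :=
        Finset.sum_le_sum fun i _ => (hF i).ncard_edgeSet_le
    _ = k * Nat.card V := by simp

theorem IsDecomposition.le {V ι : Type*} {G : SimpleGraph V} {F : ι → SimpleGraph V}
    (hdec : G.IsDecomposition F) (i : ι) : F i ≤ G := by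
  rw [← edgeSet_subset_edgeSet, ← hdec.iUnion_edgeSet]
  exact Set.subset_iUnion (fun i => (F i).edgeSet) i

theorem exists_walk_length_lt_of_ediam_lt {V : Type*} {F : SimpleGraph V} {L : ℕ} {u v : V}
    (hdiam : (F.connectedComponentMk u).toSimpleGraph.ediam < (L : ℕ∞))
    (huv : F.Reachable u v) : ∃ w : F.Walk u v, w.length < L := by
  have hv : v ∈ (F.connectedComponentMk u).supp := ConnectedComponent.sound huv.symm
  have h := (edist_le_ediam (G := (F.connectedComponentMk u).toSimpleGraph) (u := ⟨u, ConnectedComponent.connectedComponentMk_mem⟩)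
    (v := ⟨v, hv⟩)).trans_lt hdiam
  obtain ⟨p, hp⟩ := exists_walk_of_edist_ne_top h.ne_top
  refine ⟨p.map (F.connectedComponentMk u).toSimpleGraph_hom, ?_⟩
  rw [← hp] at h
  refine (Walk.length_map _ _).trans_lt ?_
  exact_mod_cast h

section HubGraph

variable {T : Type*} {k N : ℕ} {f : T → ℕ} {par : T → T} {rank : T → ℕ}

theorem hubGraph_adj_inr {a : Fin k ⊕ Fin N × T} {i : Fin N} {x : T}
    (h : (hubGraph k N f par).Adj (Sum.inr (i, x)) a) :
    (∃ j, a = Sum.inl j) ∨ ∃ y, a = Sum.inr (i, y) ∧ (par x = y ∨ par y = x) := by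
  obtain ⟨⟨⟨⟨i', x'⟩, _ | j⟩, -, h2⟩, -⟩ := mem_edgeSet_hubGraph.1 ((mem_edgeSet _).2 h)
  · right
    simp only [hubEdge, Option.elim, Sym2.eq_iff, Sum.inr.injEq, Prod.mk.injEq] at h2
    rcases h2 with ⟨⟨rfl, rfl⟩, rfl⟩ | ⟨rfl, rfl, rfl⟩
    · exact ⟨_, rfl, Or.inl rfl⟩
    · exact ⟨_, rfl, Or.inr rfl⟩
  · left
    simp only [hubEdge, Option.elim, Sym2.eq_iff, Sum.inr.injEq, reduceCtorEq, false_and,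
      false_or] at h2
    exact ⟨j, h2.1.symm⟩

/-- Along a walk that cannot reach a hub, a function that changes by at most one between a vertex
and its parent changes by at most the length of the walk. -/
theorem le_add_length_of_walk {F : SimpleGraph (Fin k ⊕ Fin N × T)}
    (hle : F ≤ hubGraph k N f par) {i : Fin N} (hi : ∀ x j, ¬ F.Adj (Sum.inr (i, x)) (Sum.inl j))
    {pot : T → ℕ} (hlip : ∀ x, pot x ≤ pot (par x) + 1 ∧ pot (par x) ≤ pot x + 1)
    {u v : Fin k ⊕ Fin N × T} (w : F.Walk u v) {x y : T} (hu : u = Sum.inr (i, x))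
    (hv : v = Sum.inr (i, y)) : pot y ≤ pot x + w.length := by
  induction w generalizing x with
  | nil =>
    rw [hu] at hv
    simp only [Sum.inr.injEq, Prod.mk.injEq, true_and] at hv
    simp [hv]
  | cons h p ih =>
    subst hu
    rcases hubGraph_adj_inr (hle h) with ⟨j, rfl⟩ | ⟨z, rfl, hz⟩
    · exact (hi x j h).elim
    · have h1 := ih rfl hv
      rw [Walk.length_cons]
      rcases hz with rfl | rfl
      · have := hlip x; omega
      · have := hlip z; omega

/-- In a copy that sends no edge of `F` to a hub, `F` has to miss many edges of the forest:
otherwise two of the tips are connected in `F`, and they are far apart. -/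
theorem lt_card_cut [Fintype T] (hrank : ∀ x, par x ≠ x → rank (par x) < rank x)
    (hroot : ∀ x y, par x = x → par y = y → x = y)
    {I : Type*} [Fintype I] {tip : I → T} {m L : ℕ} (hI : m + 2 ≤ Fintype.card I)
    {pot : I → T → ℕ} (hzero : ∀ c, pot c (tip c) = 0)
    (hlip : ∀ c x, pot c x ≤ pot c (par x) + 1 ∧ pot c (par x) ≤ pot c x + 1)
    (hfar : ∀ c d, c ≠ d → L ≤ pot c (tip d))
    {F : SimpleGraph (Fin k ⊕ Fin N × T)} (hle : F ≤ hubGraph k N f par)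
    (hdiam : ∀ K : F.ConnectedComponent, K.toSimpleGraph.ediam < (L : ℕ∞))
    {i : Fin N} (hi : ∀ x j, ¬ F.Adj (Sum.inr (i, x)) (Sum.inl j))
    [DecidablePred fun x => par x ≠ x ∧ ¬ F.Adj (Sum.inr (i, x)) (Sum.inr (i, par x))] :
    m < (Finset.univ.filter fun x =>
      par x ≠ x ∧ ¬ F.Adj (Sum.inr (i, x)) (Sum.inr (i, par x))).card := by
  classical
  by_contra! hcut
  -- Climbing from any vertex along edges of `F` stops at the root or at a missing parent edge. So
  -- `R` meets every piece, and it has at most `m + 1` elements against `m + 2` tips.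
  set R : Finset T := (Finset.univ.filter fun x =>
      par x ≠ x ∧ ¬ F.Adj (Sum.inr (i, x)) (Sum.inr (i, par x))) ∪
    Finset.univ.filter fun x => par x = x with hR
  have hRcard : R.card ≤ m + 1 := by
    refine (Finset.card_union_le _ _).trans (add_le_add hcut ?_)
    refine Finset.card_le_one.2 fun x hx y hy => hroot x y ?_ ?_
    · simpa using hx
    · simpa using hy
  have hrep : ∀ n x, rank x = n → ∃ r ∈ R, F.Reachable (Sum.inr (i, x)) (Sum.inr (i, r)) := by
    intro n
    induction n using Nat.strong_induction_on with
    | _ n ih =>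
      intro x hx
      by_cases hxR : x ∈ R
      · exact ⟨x, hxR, Reachable.refl _⟩
      · simp only [hR, Finset.mem_union, Finset.mem_filter, Finset.mem_univ, true_and,
          not_or, not_and, not_not] at hxR
        obtain ⟨r, hr, hreach⟩ := ih _ (hx ▸ hrank x hxR.2) (par x) rfl
        exact ⟨r, hr, (hxR.1 hxR.2).reachable.trans hreach⟩
  choose rep hrepR hreach using fun c : I => hrep _ (tip c) rfl
  obtain ⟨c, -, d, -, hcd, heq⟩ := Finset.exists_ne_map_eq_of_card_lt_of_maps_to
    (s := (Finset.univ : Finset I)) (t := R) (f := rep)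
    (by rw [Finset.card_univ]; omega) (fun c _ => hrepR c)
  have hcd' : F.Reachable (Sum.inr (i, tip c)) (Sum.inr (i, tip d)) :=
    (hreach c).trans (heq ▸ (hreach d).symm)
  obtain ⟨w, hw⟩ := exists_walk_length_lt_of_ediam_lt (hdiam _) hcd'
  have h1 := le_add_length_of_walk hle hi (hlip c) w rfl rfl
  have h2 := hfar c d hcd
  rw [hzero] at h1
  omega

/-- With sufficiently many copies, the hub graph of a tree with many tips, pairwise at distance at
least `L`, has no decomposition into pseudoforests one of which has bounded degree and components
of diameter less than `L`. -/
theorem not_exists_isDecomposition_hubGraph [Fintype T]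
    (hrank : ∀ x, par x ≠ x → rank (par x) < rank x)
    (hroot : ∀ x y, par x = x → par y = y → x = y) (hfk : ∀ x, f x ≤ k)
    {I : Type*} [Fintype I] {tip : I → T} {L D : ℕ} (hI : ∑ x, f x + 2 ≤ Fintype.card I)
    {pot : I → T → ℕ} (hzero : ∀ c, pot c (tip c) = 0)
    (hlip : ∀ c x, pot c x ≤ pot c (par x) + 1 ∧ pot c (par x) ≤ pot c x + 1)
    (hfar : ∀ c d, c ≠ d → L ≤ pot c (tip d))
    (hN : k * k + k * D * (k * Fintype.card T + 1) < N) :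
    ¬ ∃ F : Fin (k + 1) → SimpleGraph (Fin k ⊕ Fin N × T),
      (hubGraph k N f par).IsDecomposition F ∧ (∀ i, (F i).IsPseudoforest) ∧
        ∃ i, (∀ v, ((F i).neighborSet v).encard ≤ (D : ℕ∞)) ∧
          ∀ K : (F i).ConnectedComponent, K.toSimpleGraph.ediam < (L : ℕ∞) := by
  classical
  rintro ⟨F, hdec, hps, i₀, hdeg, hdiam⟩
  have hle := hdec.le i₀
  set B : Finset (Fin N) :=
    Finset.univ.filter fun i => ∃ x j, (F i₀).Adj (Sum.inr (i, x)) (Sum.inl j) with hB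
  have hBcard : B.card ≤ k * D := by
    have hj : ∀ j : Fin k, (Finset.univ.filter fun i : Fin N =>
        ∃ x, (F i₀).Adj (Sum.inr (i, x)) (Sum.inl j)).card ≤ D := by
      intro j
      -- Each affected copy selects one of its vertices adjacent to the hub. Copies are disjoint, so
      -- the selection is injective into a neighbour set of size at most `D`.
      have h1 : ∀ i : Fin N, ∃ v : Fin k ⊕ Fin N × T,
          (∃ x, (F i₀).Adj (Sum.inr (i, x)) (Sum.inl j)) →
            ∃ x, v = Sum.inr (i, x) ∧ (F i₀).Adj (Sum.inr (i, x)) (Sum.inl j) := by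
        intro i
        by_cases h : ∃ x, (F i₀).Adj (Sum.inr (i, x)) (Sum.inl j)
        · obtain ⟨x, hx⟩ := h
          exact ⟨_, fun _ => ⟨x, rfl, hx⟩⟩
        · exact ⟨Sum.inl j, fun h' => (h h').elim⟩
      choose g hg using h1
      have h2 := Set.encard_le_encard_of_injOn (s := {i : Fin N |
        ∃ x, (F i₀).Adj (Sum.inr (i, x)) (Sum.inl j)}) (t := (F i₀).neighborSet (Sum.inl j))
        (f := g) (by
          intro i hi
          obtain ⟨x, h3, h4⟩ := hg i hi
          rw [mem_neighborSet, h3]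
          exact h4.symm) (by
          intro i hi i' hi' heq
          obtain ⟨x, h3, -⟩ := hg i hi
          obtain ⟨x', h3', -⟩ := hg i' hi'
          rw [h3, h3'] at heq
          simp only [Sum.inr.injEq, Prod.mk.injEq] at heq
          exact heq.1)
      have h3 := h2.trans (hdeg _)
      rw [Set.encard_eq_coe_toFinset_card] at h3
      have h4 : ({i : Fin N | ∃ x, (F i₀).Adj (Sum.inr (i, x)) (Sum.inl j)} : Set _).toFinset.card
        ≤ D := by exact_mod_cast h3
      rwa [Set.toFinset_ofPred] at h4
    have hsub : B ⊆ Finset.univ.biUnion fun j : Fin k => Finset.univ.filter fun i : Fin N =>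
        ∃ x, (F i₀).Adj (Sum.inr (i, x)) (Sum.inl j) := by
      intro i hi
      simp only [hB, Finset.mem_filter, Finset.mem_univ, true_and] at hi
      obtain ⟨x, j, h⟩ := hi
      simp only [Finset.mem_biUnion, Finset.mem_filter, Finset.mem_univ, true_and]
      exact ⟨j, x, h⟩
    refine (Finset.card_le_card hsub).trans ?_
    simpa using Finset.card_biUnion_le_card_mul Finset.univ _ D fun j _ => hj j
  -- In the copies untouched by `F i₀`-edges to hubs, `τ` indexes the edges outside `F i₀`: every
  -- hub edge and each missing parent edge.
  set τ : Finset ((Fin N × T) × Option (Fin k)) := Finset.univ.filter fun t => t.1.1 ∉ B ∧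
    t.2.elim (par t.1.2 ≠ t.1.2 ∧ ¬ (F i₀).Adj (Sum.inr t.1) (Sum.inr (t.1.1, par t.1.2)))
      fun j => f t.1.2 ≤ (j : ℕ) with hτ
  have hmaps : ∀ t ∈ (τ : Set _), hubEdge par t ∈
      (hubGraph k N f par).edgeSet \ (F i₀).edgeSet := by
    rintro ⟨⟨i, x⟩, o⟩ ht
    simp only [hτ, Finset.coe_filter, Finset.mem_univ, true_and, Set.mem_ofPred_eq] at ht
    refine ⟨mem_edgeSet_hubGraph.2 ⟨⟨_, ?_, rfl⟩, ?_⟩, ?_⟩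
    · intro j hj
      rw [Option.mem_def] at hj
      subst hj
      exact ht.2
    · rw [hubEdge_isDiag_iff]
      rintro ⟨rfl, h⟩
      exact ht.2.1 h
    · cases o with
      | none => exact ht.2.2
      | some j =>
        intro h
        apply ht.1
        simp only [hB, Finset.mem_filter, Finset.mem_univ, true_and]
        exact ⟨x, j, Adj.symm h⟩
  have hinj : Set.InjOn (hubEdge par) (τ : Set ((Fin N × T) × Option (Fin k))) :=
    fun t ht t' _ h => eq_of_hubEdge_eq hrank (mem_edgeSet_hubGraph.1 (hmaps t ht).1).2 h
  have hτle : τ.card ≤ k * (k + N * Fintype.card T) := by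
    have h1 := Set.ncard_le_ncard_of_injOn _ hmaps hinj (Set.toFinite _)
    rw [Set.ncard_coe_finset] at h1
    have h2 := h1.trans (hdec.ncard_edgeSet_diff_le hps i₀)
    simpa using h2
  have hτcard : (N - k * D) * (k * Fintype.card T + 1) ≤ τ.card := by
    have h1 : τ.card = ∑ i ∈ Bᶜ, ∑ x : T, ((k - f x) +
        if par x ≠ x ∧ ¬ (F i₀).Adj (Sum.inr (i, x)) (Sum.inr (i, par x)) then 1 else 0) := by
      rw [hτ, Finset.card_filter, Fintype.sum_prod_type, Fintype.sum_prod_type,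
        ← Finset.sum_subset (Finset.subset_univ Bᶜ)]
      · refine Finset.sum_congr rfl fun i hi => Finset.sum_congr rfl fun x _ => ?_
        rw [Finset.mem_compl] at hi
        rw [Fintype.sum_option]
        simp only [hi, not_false_eq_true, true_and, Option.elim, sum_fin_ite]
        rw [add_comm]
      · intro i _ hi
        rw [Finset.mem_compl, not_not] at hi
        simp [hi]
    have h2 : ∀ i ∈ Bᶜ, k * Fintype.card T + 1 ≤ ∑ x : T, ((k - f x) +
        if par x ≠ x ∧ ¬ (F i₀).Adj (Sum.inr (i, x)) (Sum.inr (i, par x)) then 1 else 0) := by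
      intro i hi
      simp only [hB, Finset.mem_compl, Finset.mem_filter, Finset.mem_univ, true_and,
        not_exists] at hi
      -- The copy has `k|T| - Σ f` hub edges and at least `Σ f + 1` missing tree edges; the
      -- truncated subtraction is exact by `hfk`.
      have h3 := lt_card_cut hrank hroot hI hzero hlip hfar hle hdiam hi
      rw [Finset.sum_add_distrib, ← Finset.card_filter]
      have h4 : ∑ x, (k - f x) + ∑ x, f x = k * Fintype.card T := by
        rw [← Finset.sum_add_distrib, Finset.sum_congr rfl fun x _ => Nat.sub_add_cancel (hfk x)]
        simp [mul_comm]
      omega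
    rw [h1]
    refine le_trans ?_ (Finset.sum_le_sum h2)
    rw [Finset.sum_const, smul_eq_mul, Finset.card_compl, Fintype.card_fin]
    gcongr
  have hkN : k * D ≤ N := by
    have := Nat.le_mul_of_pos_right (k * D) (Nat.succ_pos (k * Fintype.card T))
    rw [Nat.succ_eq_add_one] at this
    omega
  -- The terms `N * k * |T|` cancel, leaving `N ≤ k² + kD(k|T| + 1)`, contrary to `hN`.
  have h := hτcard.trans hτle
  zify [hkN] at h hN
  nlinarith

end HubGraph

/-! ### Combs: attaching a path at every node of a forest -/

section Comb

variable {I : Type*} {h : I → ℕ} {pc : I → I} {fc : I → ℕ} {rc : I → ℕ}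

/-- The parent map of the forest that has a path with `h c + 1` vertices attached at every node `c`
of the forest with parent map `pc`. -/
def combParent (h : I → ℕ) (pc : I → I) (x : Σ c, Fin (h c + 1)) : Σ c, Fin (h c + 1) :=
  if x.2 = 0 then ⟨pc x.1, 0⟩ else ⟨x.1, ⟨x.2 - 1, by omega⟩⟩

/-- The extension of a function on the nodes by zero to the attached paths. -/
def combLift (h : I → ℕ) (fc : I → ℕ) (x : Σ c, Fin (h c + 1)) : ℕ :=
  if x.2 = 0 then fc x.1 else 0

@[simp] theorem combParent_zero (c : I) :
    combParent h pc ⟨c, 0⟩ = ⟨pc c, 0⟩ := by simp [combParent]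

@[simp] theorem combParent_succ (c : I) (j : Fin (h c)) :
    combParent h pc ⟨c, j.succ⟩ = ⟨c, j.castSucc⟩ := by
  simp [combParent, Fin.succ_ne_zero]
  rfl

@[simp] theorem combLift_zero (c : I) : combLift h fc ⟨c, 0⟩ = fc c := by simp [combLift]

@[simp] theorem combLift_succ (c : I) (j : Fin (h c)) :
    combLift h fc ⟨c, j.succ⟩ = 0 := by simp [combLift, Fin.succ_ne_zero]

theorem comb_cases {p : (Σ c, Fin (h c + 1)) → Prop} (h0 : ∀ c, p ⟨c, 0⟩)
    (hs : ∀ c (j : Fin (h c)), p ⟨c, j.succ⟩) (x) : p x := by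
  obtain ⟨c, j⟩ := x
  cases j using Fin.cases with
  | zero => exact h0 c
  | succ j => exact hs c j

theorem comb_zero_eq_iff {c d : I} :
    (⟨c, 0⟩ : Σ c, Fin (h c + 1)) = ⟨d, 0⟩ ↔ c = d := by
  constructor
  · intro heq
    exact congrArg Sigma.fst heq
  · rintro rfl; rfl

theorem comb_castSucc_ne_succ (c : I) (j : Fin (h c)) :
    (⟨c, j.castSucc⟩ : Σ c, Fin (h c + 1)) ≠ ⟨c, j.succ⟩ := by
  intro heq
  simp only [Sigma.mk.injEq, heq_eq_eq, true_and] at heq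
  exact j.castSucc_lt_succ.ne heq

theorem combParent_rank_lt (hrc : ∀ c, pc c ≠ c → rc (pc c) < rc c) (x : Σ c, Fin (h c + 1)) :
    combParent h pc x ≠ x → rc (combParent h pc x).1 + (combParent h pc x).2 < rc x.1 + x.2 := by
  induction x using comb_cases with
  | h0 c =>
    rw [combParent_zero, Ne, comb_zero_eq_iff]
    intro hc
    simpa using hrc c hc
  | hs c j => intro _; rw [combParent_succ]; simp

theorem combParent_root (hroot : ∀ c d, pc c = c → pc d = d → c = d) (x y : Σ c, Fin (h c + 1)) :
    combParent h pc x = x → combParent h pc y = y → x = y := by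
  have key : ∀ x : Σ c, Fin (h c + 1), combParent h pc x = x → ∃ c, x = ⟨c, 0⟩ ∧ pc c = c := by
    intro x
    induction x using comb_cases with
    | h0 c =>
      rw [combParent_zero, comb_zero_eq_iff]
      exact fun hc => ⟨c, rfl, hc⟩
    | hs c j =>
      rw [combParent_succ]
      exact fun heq => (comb_castSucc_ne_succ c j heq).elim
  intro hx hy
  obtain ⟨c, rfl, hc⟩ := key x hx
  obtain ⟨d, rfl, hd⟩ := key y hy
  rw [hroot c d hc hd]

theorem sum_combLift [Fintype I] : ∑ x, combLift h fc x = ∑ c, fc c := by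
  rw [Fintype.sum_sigma]
  refine Finset.sum_congr rfl fun c _ => ?_
  rw [Fin.sum_univ_succ]
  simp

theorem combLift_le {k : ℕ} (hfc : ∀ c, fc c ≤ k) (x : Σ c, Fin (h c + 1)) :
    combLift h fc x ≤ k := by
  induction x using comb_cases with
  | h0 c => simpa using hfc c
  | hs c j => simp

variable [DecidableEq I]

/-- A lower bound for the distance from the end of the path attached at `c`, for a forest on the
nodes that is properly coloured by `col`. -/
def combPot (h : I → ℕ) (col : I → Bool) (c : I) (x : Σ c, Fin (h c + 1)) : ℕ :=
  if x.1 = c then h c - x.2 else h c + x.2 + if col c = col x.1 then 2 else 1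

/-- An edge between nodes flips the colour, so away from `c` the last term switches between 1 and 2.
A neighbour of `c` has the other colour, so stepping to `c` drops the term from 1 to 0. -/
theorem combPot_lipschitz {col : I → Bool} (hcol : ∀ c, pc c ≠ c → col (pc c) ≠ col c) (c : I)
    (x : Σ c, Fin (h c + 1)) :
    combPot h col c x ≤ combPot h col c (combParent h pc x) + 1 ∧
      combPot h col c (combParent h pc x) ≤ combPot h col c x + 1 := by
  induction x using comb_cases with
  | h0 d =>
    rw [combParent_zero]
    by_cases hd : pc d = d
    · rw [hd]; omega
    · have := hcol d hd
      simp only [combPot, Fin.val_zero, Nat.sub_zero, Nat.add_zero]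
      split_ifs <;> first | omega | simp_all
  | hs d j =>
    rw [combParent_succ]
    simp only [combPot, Fin.val_succ, Fin.val_castSucc]
    have := j.isLt
    by_cases hd : d = c
    · subst hd
      simp only [if_true]
      omega
    · simp only [hd, if_false]
      omega

/-- The weight of a vertex set in a comb is controlled path by path: a path whose node is missing
does not contribute. -/
theorem sum_comb_weight_le [Fintype I] {k : ℕ} {C : ℕ} (hC : ∀ c, (k + 1) * h c ≤ C)
    (W : Finset (Σ c, Fin (h c + 1))) :
    ∑ x ∈ W, ((k + 1 : ℤ) - C * (1 + combLift h fc x -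
        if combParent h pc x ≠ x ∧ combParent h pc x ∈ W then 1 else 0)) ≤
      ∑ c, if (⟨c, 0⟩ : Σ c, Fin (h c + 1)) ∈ W then
        ((k + 1 : ℤ) * (h c + 1) - C * (1 + fc c -
          if pc c ≠ c ∧ (⟨pc c, 0⟩ : Σ c, Fin (h c + 1)) ∈ W then 1 else 0)) else 0 := by
  set t : (Σ c, Fin (h c + 1)) → ℤ := fun x => (k + 1 : ℤ) - C * (1 + combLift h fc x -
    if combParent h pc x ≠ x ∧ combParent h pc x ∈ W then 1 else 0) with ht
  rw [← Finset.filter_univ_mem W, Finset.sum_filter, Fintype.sum_sigma, Finset.filter_univ_mem]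
  refine Finset.sum_le_sum fun c _ => ?_
  rw [Fin.sum_univ_succ]
  have hC' : ((k + 1 : ℤ)) * h c ≤ C := by exact_mod_cast hC c
  have hle : ∀ j : Fin (h c),
      (if (⟨c, j.succ⟩ : Σ c, Fin (h c + 1)) ∈ W then t ⟨c, j.succ⟩ else 0) ≤ (k + 1 : ℤ) := by
    intro j
    split_ifs
    · simp only [ht, combLift_succ]
      split_ifs <;> simp
    · positivity
  have hcard : ∀ s : Finset (Fin (h c)),
      ∑ j ∈ s, (if (⟨c, j.succ⟩ : Σ c, Fin (h c + 1)) ∈ W then t ⟨c, j.succ⟩ else 0) ≤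
        (k + 1 : ℤ) * s.card := by
    intro s
    refine (Finset.sum_le_sum fun j _ => hle j).trans ?_
    simp [mul_comm]
  by_cases hA : (⟨c, 0⟩ : Σ c, Fin (h c + 1)) ∈ W
  · rw [if_pos hA, if_pos hA]
    have h1 := hcard Finset.univ
    rw [Finset.card_univ, Fintype.card_fin] at h1
    simp only [ht, combLift_zero, combParent_zero, Ne, comb_zero_eq_iff] at h1 ⊢
    linarith
  · rw [if_neg hA, if_neg hA, zero_add]
    by_cases hex : ∃ j : Fin (h c), (⟨c, j.succ⟩ : Σ c, Fin (h c + 1)) ∈ W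
    · obtain ⟨j₁, hj₁⟩ := hex
      -- The vertex of `W` on this path nearest to the missing node has its parent outside `W`. It
      -- pays a full `C`, which outweighs at most `h c` gains of `k + 1`.
      obtain ⟨j, hj, hmin⟩ := (Finset.univ.filter fun j : Fin (h c) =>
        (⟨c, j.succ⟩ : Σ c, Fin (h c + 1)) ∈ W).exists_min_image id ⟨j₁, by simpa using hj₁⟩
      simp only [Finset.mem_filter, Finset.mem_univ, true_and, id] at hj hmin
      have hnot : (⟨c, j.castSucc⟩ : Σ c, Fin (h c + 1)) ∉ W := by
        intro hmem
        rcases Fin.eq_zero_or_eq_succ j.castSucc with h0 | ⟨i, hi⟩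
        · rw [h0] at hmem
          exact hA hmem
        · rw [hi] at hmem
          have h1 := hmin i hmem
          have h2 := congrArg Fin.val hi
          simp only [Fin.val_castSucc, Fin.val_succ] at h2
          rw [Fin.le_def] at h1
          omega
      rw [← Finset.add_sum_erase _ _ (Finset.mem_univ j), if_pos hj]
      have h1 := hcard (Finset.univ.erase j)
      rw [Finset.card_erase_of_mem (Finset.mem_univ j), Finset.card_univ, Fintype.card_fin,
        Nat.cast_sub (by have := j.isLt; omega)] at h1
      have h2 : t ⟨c, j.succ⟩ = (k + 1 : ℤ) - C := by
        simp only [ht, combLift_succ, combParent_succ, hnot, and_false, if_false]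
        simp
      refine (add_le_add h2.le h1).trans ?_
      push_cast
      linarith
    · push Not at hex
      exact le_of_eq (Finset.sum_eq_zero fun j _ => if_neg (hex j))

end Comb

/-! ### The caterpillar and the weights of its node sets -/

/-- The nodes of a caterpillar: a path with `2 * b + 1` nodes, alternately light and heavy, and
`κ` leaves at each heavy node. -/
abbrev CatNode (b κ : ℕ) : Type := Fin (b + 1) ⊕ Fin b ⊕ Fin b × Fin κ

namespace CatNode

variable {b κ : ℕ}

/-- The caterpillar is rooted at the first node of its path. -/
def parent : CatNode b κ → CatNode b κ
  | Sum.inl i => Fin.cases (Sum.inl 0) (fun i => Sum.inr (Sum.inl i)) i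
  | Sum.inr (Sum.inl i) => Sum.inl i.castSucc
  | Sum.inr (Sum.inr (i, _)) => Sum.inr (Sum.inl i)

def rank : CatNode b κ → ℕ
  | Sum.inl i => 2 * i
  | Sum.inr (Sum.inl i) => 2 * i + 1
  | Sum.inr (Sum.inr (i, _)) => 2 * i + 2

/-- It doubles as the proper colouring of the nodes that `combPot` requires. -/
def heavy : CatNode b κ → Bool
  | Sum.inl _ => false
  | Sum.inr (Sum.inl _) => true
  | Sum.inr (Sum.inr _) => false

/-- The number of hubs to which a node is not joined. -/
def defect : CatNode b κ → ℕ
  | Sum.inl i => if i = 0 ∨ i = Fin.last b then 0 else 1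
  | Sum.inr (Sum.inl _) => κ + 1
  | Sum.inr (Sum.inr _) => 0

/-- The number of edges of the path attached at a node. -/
def height (ℓ α : ℕ) (c : CatNode b κ) : ℕ := ℓ + if heavy c then α else 0

theorem rank_parent_lt (c : CatNode b κ) : parent c ≠ c → rank (parent c) < rank c := by
  rcases c with i | i | ⟨i, j⟩
  · cases i using Fin.cases with
    | zero => intro h; exact (h rfl).elim
    | succ i => intro _; simp [parent, rank]; omega
  · intro _; simp [parent, rank]
  · intro _; simp [parent, rank]

theorem eq_of_parent_eq (c d : CatNode b κ) : parent c = c → parent d = d → c = d := by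
  have key : ∀ c : CatNode b κ, parent c = c → c = Sum.inl 0 := by
    rintro (i | i | ⟨i, j⟩) h
    · cases i using Fin.cases with
      | zero => rfl
      | succ i => simp [parent] at h
    · simp [parent] at h
    · simp [parent] at h
  intro hc hd
  rw [key c hc, key d hd]

theorem heavy_parent_ne (c : CatNode b κ) : parent c ≠ c → heavy (parent c) ≠ heavy c := by
  rcases c with i | i | ⟨i, j⟩
  · cases i using Fin.cases with
    | zero => intro h; exact (h rfl).elim
    | succ i => intro _; simp [parent, heavy]
  · intro _; simp [parent, heavy]
  · intro _; simp [parent, heavy]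

theorem defect_le (c : CatNode b κ) : defect c ≤ κ + 1 := by
  rcases c with i | i | ⟨i, j⟩ <;> simp only [defect]
  · split_ifs <;> omega
  · exact le_rfl
  · omega

/-- A heavy node's defect counts itself and its `κ` leaves, an inner light node's counts itself. The
two ends of the spine remain: the surplus of two tips needed for the pigeonhole. -/
theorem sum_defect_add_two (b κ : ℕ) :
    ∑ c : CatNode (b + 1) κ, defect c + 2 = Fintype.card (CatNode (b + 1) κ) := by
  have h1 : ∑ i : Fin (b + 2), defect (Sum.inl i : CatNode (b + 1) κ) = b := by
    rw [Fin.sum_univ_succ, Fin.sum_univ_castSucc]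
    have h2 : ∀ i : Fin b, i.castSucc.succ ≠ Fin.last (b + 1) := by
      intro i h
      have := congrArg Fin.val h
      simp at this
      omega
    simp [defect, h2, Fin.succ_ne_zero]
  rw [Fintype.sum_sum_type, Fintype.sum_sum_type, h1]
  simp [defect]
  ring

/-- Nodes of equal colour are at distance at least 2, and `α ≤ 1`. For a light and a heavy node,
possibly adjacent, the longer path at the heavy one supplies the `α`. -/
theorem le_height_add_height {ℓ α : ℕ} (hα : α = 0 ∨ α = 1) (c d : CatNode b κ) :
    2 * ℓ + 1 + α ≤ height ℓ α c + height ℓ α d + if heavy c = heavy d then 2 else 1 := by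
  unfold height
  cases heavy c <;> cases heavy d <;> simp <;> omega

/-- The weight of a subset of the path `s 0, p 0, s 1, p 1, …, s b`, where every node but the
first pays for the edge to its predecessor. -/
theorem path_weight_le {α C : ℤ} (hα : 0 ≤ α) (hαC : α ≤ C) (b : ℕ) (s : Fin (b + 1) → ℤ)
    (p : Fin b → ℤ) (hs : ∀ i, s i = 0 ∨ s i = 1) (hp : ∀ i, p i = 0 ∨ p i = 1) :
    ((∀ i, s i = 1) ∧ -α * s 0 + ∑ i : Fin b, (p i * (α - C + C * s i.castSucc) +
      s i.succ * (C * p i - α - C)) ≤ -α) ∨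
    -α * s 0 + ∑ i : Fin b, (p i * (α - C + C * s i.castSucc) +
      s i.succ * (C * p i - α - C)) ≤ -C * s (Fin.last b) := by
  -- The second alternative remembers the last light node because the next heavy node gains `C * s`
  -- from it; the term `-C * s` has prepaid this gain.
  induction b with
  | zero =>
    rcases hs 0 with h | h
    · right; simp [h]
    · left
      refine ⟨fun i => by rwa [Fin.fin_one_eq_zero i], ?_⟩
      simp [h]
  | succ b ih =>
    have h := ih (fun i => s i.castSucc) (fun i => p i.castSucc) (fun i => hs _) (fun i => hp _)
    rw [Fin.sum_univ_castSucc]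
    simp only [Fin.castSucc_zero, Fin.succ_last, Fin.succ_castSucc] at h ⊢
    rcases h with ⟨h1, h2⟩ | h2
    · have h3 := h1 (Fin.last b)
      simp only [h3] at h2 ⊢
      rcases hp (Fin.last b) with hp' | hp' <;> rcases hs (Fin.last (b + 1)) with hs' | hs' <;>
        simp only [hp', hs'] at h2 ⊢
      · right; linarith
      · right; linarith
      · right; linarith
      · left
        refine ⟨fun i => ?_, by linarith⟩
        cases i using Fin.lastCases with
        | last => exact hs'
        | cast i => exact h1 i
    · right
      rcases hp (Fin.last b) with hp' | hp' <;> rcases hs (Fin.last (b + 1)) with hs' | hs' <;>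
        rcases hs (Fin.last b).castSucc with hs'' | hs'' <;>
        simp only [hp', hs', hs''] at h2 ⊢ <;> linarith

open Classical in
/-- The weight of a set of nodes of the caterpillar is nonpositive unless the set contains all
light nodes of the path. -/
theorem sum_weight_le {ℓ α : ℕ} {C : ℤ} (hC : C = (ℓ + 1) * (κ + 2) + α)
    (A : CatNode (b + 1) κ → Prop) :
    ∑ c, (if A c then ((κ + 2 : ℤ) * (height ℓ α c + 1) - C * (1 + defect c -
      if parent c ≠ c ∧ A (parent c) then 1 else 0)) else 0) ≤
      if ∀ i, A (Sum.inl i) then C else 0 := by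
  set φ : CatNode (b + 1) κ → ℤ := fun c => if A c then
    ((κ + 2 : ℤ) * (height ℓ α c + 1) - C * (1 + defect c -
      if parent c ≠ c ∧ A (parent c) then 1 else 0)) else 0 with hφ
  set s : Fin (b + 2) → ℤ := fun i => if A (Sum.inl i) then 1 else 0 with hs
  set p : Fin (b + 1) → ℤ := fun i => if A (Sum.inr (Sum.inl i)) then 1 else 0 with hp
  have hα : (0 : ℤ) ≤ α := by positivity
  have hαC : (α : ℤ) ≤ C := by rw [hC]; nlinarith
  -- By `hC`, a path at a light node brings `(κ + 2)(ℓ + 1) = C - α`, and one at a heavy node `C +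
  -- (κ + 1)α`.
  have hz0 : φ (Sum.inl 0) = -α * s 0 := by
    simp only [hφ, hs, parent, defect, height, heavy]
    split_ifs <;> (simp_all; try linarith)
  -- The last light node has defect 0 instead of 1, hence the extra `C`.
  have hz : ∀ i : Fin (b + 1), φ (Sum.inl i.succ) = s i.succ * (C * p i - α - C) +
      if i = Fin.last b then C * s i.succ else 0 := by
    intro i
    have h1 : i.succ = Fin.last (b + 1) ↔ i = Fin.last b := by
      rw [← Fin.succ_last, Fin.succ_inj]
    simp only [hφ, hs, hp, parent, defect, height, heavy, Fin.cases_succ, Fin.succ_ne_zero,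
      h1, false_or]
    split_ifs <;> simp_all <;> linarith
  have hy : ∀ i : Fin (b + 1), φ (Sum.inr (Sum.inl i)) =
      p i * ((κ + 1) * α - (κ + 1) * C + C * s i.castSucc) := by
    intro i
    simp only [hφ, hs, hp, parent, defect, height, heavy]
    split_ifs <;> simp_all <;> linarith
  have hleaf : ∀ (i : Fin (b + 1)) (j : Fin κ), φ (Sum.inr (Sum.inr (i, j))) ≤
      p i * (C - α) := by
    intro i j
    simp only [hφ, hp, parent, defect, height, heavy]
    split_ifs <;> simp_all <;> linarith
  -- The `κ` leaves of a heavy node return at most `κ(C - α)`, which turns its `(κ + 1)(α - C)` into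
  -- the `α - C` of `path_weight_le`.
  have hsum : ∑ c, φ c ≤ (-α * s 0 + ∑ i : Fin (b + 1), (p i * (α - C + C * s i.castSucc) +
      s i.succ * (C * p i - α - C))) + C * s (Fin.last (b + 1)) := by
    rw [Fintype.sum_sum_type, Fintype.sum_sum_type, Fin.sum_univ_succ, hz0,
      Finset.sum_congr rfl fun i _ => hz i, Finset.sum_congr rfl fun i _ => hy i,
      Fintype.sum_prod_type, Finset.sum_add_distrib, Finset.sum_ite_eq']
    have h1 : ∑ i : Fin (b + 1), ∑ j : Fin κ, φ (Sum.inr (Sum.inr (i, j))) ≤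
        ∑ i : Fin (b + 1), κ * (p i * (C - α)) := by
      refine Finset.sum_le_sum fun i _ => (Finset.sum_le_sum fun j _ => hleaf i j).trans ?_
      simp
    have h2 : ∑ i : Fin (b + 1), p i * (α - C + C * s i.castSucc) =
        ∑ i : Fin (b + 1), p i * ((κ + 1) * α - (κ + 1) * C + C * s i.castSucc) +
          ∑ i : Fin (b + 1), κ * (p i * (C - α)) := by
      rw [← Finset.sum_add_distrib]
      exact Finset.sum_congr rfl fun i _ => by ring
    rw [Finset.sum_add_distrib, h2]
    simp only [Finset.mem_univ, if_true, Fin.succ_last]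
    linarith
  refine hsum.trans ?_
  rcases path_weight_le hα hαC (b + 1) s p (fun i => by simp only [hs]; split_ifs <;> simp)
    (fun i => by simp only [hp]; split_ifs <;> simp) with ⟨h1, h2⟩ | h2
  · rw [if_pos fun i => by by_contra h; have := h1 i; simp [hs, h] at this,
      h1 (Fin.last (b + 1))]
    linarith
  · split_ifs <;> linarith

end CatNode

/-! ### From weights to densities, and the final choice of parameters -/

/-- The density bound for the caterpillar with attached paths. -/
theorem sum_catNode_comb_le {κ ℓ α b : ℕ} (hα : α ≤ 1) {δ : ℝ} (hδ : 0 < δ) (hb : 1 / δ ≤ b)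
    (W : Finset (Σ c : CatNode (b + 1) κ, Fin (CatNode.height ℓ α c + 1))) :
    ((∑ x ∈ W, ((κ + 1 - combLift (CatNode.height ℓ α) CatNode.defect x) +
      if combParent (CatNode.height ℓ α) CatNode.parent x ≠ x ∧
        combParent (CatNode.height ℓ α) CatNode.parent x ∈ W then 1 else 0) : ℕ) : ℝ) ≤
      (κ + 1 + (ℓ * (κ + 2) + α) / ((ℓ + 1) * (κ + 2) + α) + δ) * W.card := by
  classical
  set C : ℕ := (ℓ + 1) * (κ + 2) + α with hC
  clear_value C
  have hheight : ∀ c : CatNode (b + 1) κ, (κ + 1 + 1) * CatNode.height ℓ α c ≤ C := by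
    intro c
    have : CatNode.height ℓ α c ≤ ℓ + 1 := by
      unfold CatNode.height
      split_ifs <;> omega
    calc (κ + 1 + 1) * CatNode.height ℓ α c ≤ (κ + 2) * (ℓ + 1) := by gcongr
      _ ≤ C := by rw [hC, mul_comm]; omega
  have h1 := sum_comb_weight_le (pc := CatNode.parent) (fc := CatNode.defect) hheight W
  have h2 := CatNode.sum_weight_le (ℓ := ℓ) (α := α) (C := C) (b := b) (κ := κ)
    (by rw [hC]; push_cast; ring) fun c => ⟨c, 0⟩ ∈ W
  have h3 : ((κ + 1 : ℕ) + 1 : ℤ) = κ + 2 := by push_cast; ring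
  rw [h3] at h1
  have h4 := h1.trans (le_trans (le_of_eq (Finset.sum_congr rfl fun c _ => by congr!)) h2)
  set S : ℕ := ∑ x ∈ W, ((κ + 1 - combLift (CatNode.height ℓ α) CatNode.defect x) +
      if combParent (CatNode.height ℓ α) CatNode.parent x ≠ x ∧
        combParent (CatNode.height ℓ α) CatNode.parent x ∈ W then 1 else 0) with hS
  -- The weight is `C` times the excess of `S` over the target density, without `δ`, times `|W|`.
  have h5 : ∑ x ∈ W, ((κ + 2 : ℤ) - C * (1 + combLift (CatNode.height ℓ α) CatNode.defect x -
        if combParent (CatNode.height ℓ α) CatNode.parent x ≠ x ∧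
          combParent (CatNode.height ℓ α) CatNode.parent x ∈ W then 1 else 0)) =
      (κ + 2) * W.card - C * (κ + 2) * W.card + C * S := by
    rw [hS, Nat.cast_sum, Finset.mul_sum, ← sub_mul, mul_comm _ (W.card : ℤ), ← nsmul_eq_mul,
      ← Finset.sum_const, ← Finset.sum_add_distrib]
    refine Finset.sum_congr rfl fun x _ => ?_
    rw [Nat.cast_add, Nat.cast_sub (combLift_le CatNode.defect_le x)]
    push_cast
    ring
  rw [h5] at h4
  have hCpos : (0 : ℝ) < C := by rw [hC]; positivity
  have h6 : (κ + 2 : ℝ) * W.card - C * (κ + 2) * W.card + C * S ≤ C * (δ * W.card) := by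
    have h7 : ((κ + 2 : ℝ) * W.card - C * (κ + 2) * W.card + C * S) ≤
        if ∀ i, (⟨Sum.inl i, 0⟩ : Σ c : CatNode (b + 1) κ, Fin (CatNode.height ℓ α c + 1)) ∈ W
          then (C : ℝ) else 0 := by
      exact_mod_cast h4
    refine h7.trans ?_
    split_ifs with hall
    -- A surplus of `C` occurs only if `W` contains all `b + 2` light spine nodes; then `δ * |W| ≥
    -- 1` by the choice of `b`.
    · have h8 : b + 2 ≤ W.card := by
        have := Finset.card_le_card_of_injOn (s := (Finset.univ : Finset (Fin (b + 2)))) (t := W)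
          (fun i => ⟨Sum.inl i, 0⟩) (fun i _ => hall i) (fun i _ j _ h => by
            simpa using comb_zero_eq_iff.1 h)
        simpa using this
      have h9 : (b : ℝ) ≤ W.card := by exact_mod_cast (by omega : b ≤ W.card)
      have h10 : 1 ≤ δ * W.card := by
        rw [div_le_iff₀ hδ] at hb
        nlinarith
      nlinarith
    · exact mul_nonneg hCpos.le (mul_nonneg hδ.le (Nat.cast_nonneg _))
  have h11 : ((κ : ℝ) + 1 + (ℓ * (κ + 2) + α) / ((ℓ + 1) * (κ + 2) + α) + δ) * W.card =
      (C * (κ + 2) * W.card - (κ + 2) * W.card + C * (δ * W.card)) / C := by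
    have h12 : ((ℓ : ℝ) + 1) * (κ + 2) + α = C := by rw [hC]; push_cast; ring
    have h13 : (ℓ : ℝ) * (κ + 2) + α = C - (κ + 2) := by rw [← h12]; ring
    rw [h12, h13, eq_div_iff hCpos.ne']
    linear_combination (W.card : ℝ) * div_mul_cancel₀ ((C : ℝ) - (κ + 2)) hCpos.ne'
  rw [h11, le_div_iff₀ hCpos]
  linarith

end SimpleGraph

theorem theorem1p11 (k ℓ D α : ℕ) (ε : ℝ) (hk : 1 ≤ k) (hα : α = 0 ∨ α = 1) (hε : 0 < ε) :
    ∃ (V : Type) (_ : Finite V) (G : SimpleGraph V),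
      G.fracArboricity <
        (k : ℝ) + ((ℓ : ℝ) * ((k : ℝ) + 1) + (α : ℝ)) /
          (((ℓ : ℝ) + 1) * ((k : ℝ) + 1) + (α : ℝ)) + ε ∧
      ¬ ∃ F : Fin (k + 1) → SimpleGraph V,
          G.IsDecomposition F ∧
          (∀ i, (F i).IsPseudoforest) ∧
          ∃ i, (∀ v : V, ((F i).neighborSet v).encard ≤ (D : ℕ∞)) ∧
            ∀ K : (F i).ConnectedComponent,
              K.toSimpleGraph.ediam < ((2 * ℓ + 1 + α : ℕ) : ℕ∞) := by
  classical
  obtain ⟨κ, rfl⟩ : ∃ κ, k = κ + 1 := ⟨k - 1, by omega⟩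
  -- One half of `ε` absorbs the surplus weight, the other makes the inequality strict.
  obtain ⟨b, hb⟩ := exists_nat_ge (1 / (ε / 2))
  let h : SimpleGraph.CatNode (b + 1) κ → ℕ := SimpleGraph.CatNode.height ℓ α
  let T : Type := Σ c, Fin (h c + 1)
  let N := (κ + 1) * (κ + 1) + (κ + 1) * D * ((κ + 1) * Fintype.card T + 1) + 1
  have hrank := SimpleGraph.combParent_rank_lt (h := h) (SimpleGraph.CatNode.rank_parent_lt)
  refine ⟨Fin (κ + 1) ⊕ Fin N × T, inferInstance, SimpleGraph.hubGraph (κ + 1) N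
    (SimpleGraph.combLift h SimpleGraph.CatNode.defect)
    (SimpleGraph.combParent h SimpleGraph.CatNode.parent), ?_, ?_⟩
  · have hQ : (1 : ℝ) ≤ κ + 1 + (ℓ * (κ + 2) + α) / ((ℓ + 1) * (κ + 2) + α) + ε / 2 := by
      have h1 : (0 : ℝ) ≤ (ℓ * (κ + 2) + α) / ((ℓ + 1) * (κ + 2) + α) := by positivity
      have h2 : (0 : ℝ) ≤ κ := by positivity
      linarith
    refine (SimpleGraph.fracArboricity_hubGraph_le
      (rank := fun x : T => SimpleGraph.CatNode.rank x.1 + x.2) hrank hQ fun W => ?_).trans_lt ?_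
    · convert SimpleGraph.sum_catNode_comb_le (by omega) (half_pos hε) hb W
    · push_cast
      rw [show (κ : ℝ) + 1 + 1 = κ + 2 by ring]
      linarith
  · refine SimpleGraph.not_exists_isDecomposition_hubGraph
      (rank := fun x : T => SimpleGraph.CatNode.rank x.1 + x.2) hrank
      (SimpleGraph.combParent_root SimpleGraph.CatNode.eq_of_parent_eq)
      (SimpleGraph.combLift_le SimpleGraph.CatNode.defect_le)
      (I := SimpleGraph.CatNode (b + 1) κ) (tip := fun c => ⟨c, Fin.last _⟩)
      (pot := SimpleGraph.combPot h SimpleGraph.CatNode.heavy) ?_ ?_ ?_ ?_ (Nat.lt_succ_self _)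
    · rw [SimpleGraph.sum_combLift, SimpleGraph.CatNode.sum_defect_add_two]
    · intro c
      simp [SimpleGraph.combPot]
    · exact SimpleGraph.combPot_lipschitz SimpleGraph.CatNode.heavy_parent_ne
    · intro c d hcd
      have := SimpleGraph.CatNode.le_height_add_height (ℓ := ℓ) hα c d
      simpa [SimpleGraph.combPot, hcd.symm, h] using this
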